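/- For a normed space $X$ over $\mathbb{K}\in\{\mathbb{R},\mathbb{C}\}$ and a unit vector $x\in X$, let $J(x)=\{f\in X^*:\|f\|=1,\ f(x)=1\}$ be the set of supporting functionals of $x$; for an integer $k\ge 0$, the vector $x$ is called $k$-smooth if $\dim_{\mathbb{K}}\operatorname{span}J(x)=k$. For a Hilbert space $\mathbb{H}$, let $\mathbb{L}(\mathbb{H})$ be the normed space of bounded linear operators on $\mathbb{H}$ with the operator norm (a unit-norm operator is $k$-smooth if it is $k$-smooth as a vector of $\mathbb{L}(\mathbb{H})$), for $T\in\mathbb{L}(\mathbb{H})$ let $M_T=\{x\in\mathbb{H}:\|x\|=1,\ \|Tx\|=\|T\|\}$, and for a subspace $H_0$ let $S_{H_0}=\{x\in H_0:\|x\|=1\}$. Theorem. Let $\mathbb{H}$ be a separable complex Hilbert space, let $T\in\mathbb{L}(\mathbb{H})$ with $\|T\|=1$, and let $n\ge 0$ be an integer. Then $T$ is $n^2$-smooth if and only if there is a finite-dimensional subspace $H_0$ of $\mathbb{H}$ with $\dim H_0=n$, $M_T=S_{H_0}$ and $\|T|_{H_0^\perp}\|<1$. Likewise, let $\mathbb{H}$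 be a separable real Hilbert space, let $T\in\mathbb{L}(\mathbb{H})$ with $\|T\|=1$, and let $n\ge 0$ be an integer. Then $T$ is $\binom{n+1}{2}$-smooth if and only if there is a finite-dimensional subspace $H_0$ of $\mathbb{H}$ with $\dim H_0=n$, $M_T=S_{H_0}$ and $\|T|_{H_0^\perp}\|<1$. -/

import Mathlib

/-- The set `J(x)` of supporting linear functionals of a (unit) vector `x`: the continuous linear
functionals of norm one taking the value one at `x`. -/
def supportingFunctionals (𝕜 : Type*) {X : Type*} [RCLike 𝕜] [NormedAddCommGroup X]
    [NormedSpace 𝕜 X] (x : X) : Set (StrongDual 𝕜 X) :=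
  {f | ‖f‖ = 1 ∧ f x = 1}

/-- A unit vector `x` is `k`-smooth if the linear span of `J(x)` has dimension exactly `k`.
The dimension is the cardinal one, so that a span of infinite dimension is never `k`-smooth. -/
def IsSmoothOfOrder (𝕜 : Type*) {X : Type*} [RCLike 𝕜] [NormedAddCommGroup X]
    [NormedSpace 𝕜 X] (k : ℕ) (x : X) : Prop :=
  ‖x‖ = 1 ∧ Module.rank 𝕜 (Submodule.span 𝕜 (supportingFunctionals 𝕜 x)) = (k : Cardinal)

/-- The norm attainment set `M_T` of a bounded operator `T`. -/
def normAttainmentSet {𝕜 X Y : Type*} [RCLike 𝕜] [NormedAddCommGroup X] [NormedSpace 𝕜 X]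
    [NormedAddCommGroup Y] [NormedSpace 𝕜 Y] (T : X →L[𝕜] Y) : Set X :=
  {x | ‖x‖ = 1 ∧ ‖T x‖ = ‖T‖}

/-!
Write `T†` for the adjoint of a contraction `T`. Since `‖x - T†T x‖² ≤ ‖x‖² - ‖T x‖²`, the norm
attainment set of a norm one operator is always the unit sphere of the fixed space of `T†T`
(`normAttainmentSet_eq_isometrySubspace`). The content of the theorem is thus how the dimension of
the span of the supporting functionals depends on this space `H₀` and on the gap `‖T|H₀ᗮ‖ < 1`.

*With the gap.* If `⟪T x, A x⟫ = 0` on `H₀`, then `‖T + t A‖² ≤ 1 + C t²` for all real `t`, because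
the gap absorbs every other first order term (`exists_norm_add_smul_sq_le`). Hence a supporting
functional of `T` kills such `A`, that is, it depends only on the quadratic form `x ↦ ⟪T x, A x⟫`
on `H₀`. Conversely `A ↦ ⟪T x, A x⟫` is a supporting functional for each unit vector `x` of `H₀`,
so the span of the supporting functionals is the span of these evaluations. Over `ℂ` polarization
recovers all entries `⟪T e_i, A e_j⟫` in an orthonormal basis, which gives dimension `n ^ 2`; over
`ℝ` only the symmetrized entries are seen, which gives `(n + 1).choose 2`. Rank one operators show
that the entries are independent.

*Without the gap.* Suppose `T` has norm one on the complement of every finite-dimensional subspace.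
Then there is an orthogonal sequence on which `T` is asymptotically isometric, and splitting it into
infinitely many infinite parts gives mutually orthogonal closed subspaces `U_k`, with projections
`P_k`, such that `‖T P_k‖ = 1`. A functional supporting `T P_k` vanishes on `T P_l` for `l ≠ k` and
on `T (1 - P_k)`, since adding or subtracting these operators keeps `T P_k` in the unit ball. So it
supports `T`, and these functionals are independent
(`exists_linearIndependent_supportingFunctionals`). If the span is finite-dimensional there is
therefore a finite-dimensional `F` with `‖T|Fᗮ‖ < 1`; a compactness argument replaces `F` by `H₀`
(`norm_comp_isometrySubspace_orthogonal_lt_one`), and the dimension count applies.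
-/

section

open scoped InnerProductSpace
open RCLike

/-! ### Linear independence and spans of functionals -/

theorem linearIndependent_of_forall_exists_separating {𝕜 V ι : Type*} [RCLike 𝕜]
    [NormedAddCommGroup V] [NormedSpace 𝕜 V] (φ : ι → StrongDual 𝕜 V)
    (h : ∀ i, ∃ v, φ i v ≠ 0 ∧ ∀ j, j ≠ i → φ j v = 0) : LinearIndependent 𝕜 φ := by
  rw [linearIndependent_iff']
  intro s c hc i hi
  obtain ⟨v, hv, hv'⟩ := h i
  have := congrArg (fun f : StrongDual 𝕜 V => f v) hc
  simp only [sum_apply, smul_apply,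
    zero_apply, smul_eq_mul] at this
  rw [Finset.sum_eq_single i (fun j _ hj => by rw [hv' j hj, mul_zero])
    (fun hi' => absurd hi hi')] at this
  exact (mul_eq_zero.mp this).resolve_right hv

theorem StrongDual.mem_span_range_of_forall_eq_zero {𝕜 V ι : Type*} [RCLike 𝕜]
    [NormedAddCommGroup V] [NormedSpace 𝕜 V] [Finite ι] (φ : ι → StrongDual 𝕜 V)
    (f : StrongDual 𝕜 V) (h : ∀ v, (∀ i, φ i v = 0) → f v = 0) :
    f ∈ Submodule.span 𝕜 (Set.range φ) := by
  have key : (f : V →ₗ[𝕜] 𝕜) ∈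
      Submodule.span 𝕜 (Set.range fun i => (φ i : V →ₗ[𝕜] 𝕜)) := by
    refine mem_span_of_iInf_ker_le_ker fun v hv => ?_
    simp only [Submodule.mem_iInf, LinearMap.mem_ker, ContinuousLinearMap.coe_coe] at hv ⊢
    exact h v hv
  have hr : (Set.range fun i => (φ i : V →ₗ[𝕜] 𝕜)) =
      (ContinuousLinearMap.coeLM 𝕜 : (V →L[𝕜] 𝕜) →ₗ[𝕜] V →ₗ[𝕜] 𝕜) '' Set.range φ := by
    rw [← Set.range_comp]; rfl
  rw [hr, ← Submodule.map_span] at key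
  obtain ⟨g, hg, hgf⟩ := key
  have : g = f := ContinuousLinearMap.coe_injective hgf
  exact this ▸ hg

theorem StrongDual.rank_span_eq_card {𝕜 V ι : Type*} [RCLike 𝕜] [NormedAddCommGroup V]
    [NormedSpace 𝕜 V] [Fintype ι] {J : Set (StrongDual 𝕜 V)} {φ : ι → StrongDual 𝕜 V}
    (hφ : LinearIndependent 𝕜 φ)
    (hJ : Submodule.span 𝕜 J = Submodule.span 𝕜 (Set.range φ)) :
    Module.rank 𝕜 (Submodule.span 𝕜 J) = (Fintype.card ι : Cardinal) := by
  rw [hJ, ← finrank_span_eq_card hφ]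
  have : FiniteDimensional 𝕜 (Submodule.span 𝕜 (Set.range φ)) :=
    FiniteDimensional.span_of_finite 𝕜 (Set.finite_range φ)
  exact (Module.finrank_eq_rank 𝕜 _).symm

theorem finiteDimensional_of_rank_eq_natCast {𝕜 V : Type*} [RCLike 𝕜] [NormedAddCommGroup V]
    [NormedSpace 𝕜 V] {p : Submodule 𝕜 V} {n : ℕ} (h : Module.rank 𝕜 p = n) :
    FiniteDimensional 𝕜 p :=
  Module.rank_lt_aleph0_iff.mp (h ▸ Cardinal.natCast_lt_aleph0)

variable {𝕜 H : Type*} [RCLike 𝕜] [NormedAddCommGroup H] [InnerProductSpace 𝕜 H]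

/-! ### Contractions and their norm attainment set -/

/-- For a contraction `T`, the defect `x - T†T x` is controlled by the loss of norm. -/
theorem norm_sub_adjoint_apply_sq_le [CompleteSpace H] {T : H →L[𝕜] H} (hT : ‖T‖ ≤ 1) (x : H) :
    ‖x - T.adjoint (T x)‖ ^ 2 ≤ ‖x‖ ^ 2 - ‖T x‖ ^ 2 := by
  have h1 : re ⟪x, T.adjoint (T x)⟫_𝕜 = ‖T x‖ ^ 2 := by
    rw [ContinuousLinearMap.adjoint_inner_right, inner_self_eq_norm_sq]
  have h2 : ‖T.adjoint (T x)‖ ≤ ‖T x‖ :=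
    (T.adjoint).le_of_opNorm_le (by simpa using hT) (T x) |>.trans (by simp)
  have h3 : ‖T.adjoint (T x)‖ ^ 2 ≤ ‖T x‖ ^ 2 := by gcongr
  rw [@norm_sub_sq 𝕜, h1]
  linarith

theorem adjoint_apply_apply_eq_of_norm_eq [CompleteSpace H] {T : H →L[𝕜] H} (hT : ‖T‖ ≤ 1)
    {x : H} (hx : ‖T x‖ = ‖x‖) : T.adjoint (T x) = x := by
  have h := norm_sub_adjoint_apply_sq_le hT x
  rw [hx, sub_self] at h
  have : ‖x - T.adjoint (T x)‖ = 0 := by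
    have := norm_nonneg (x - T.adjoint (T x)); nlinarith
  exact (sub_eq_zero.mp (norm_eq_zero.mp this)).symm

theorem norm_apply_eq_iff_adjoint_apply_apply_eq [CompleteSpace H] {T : H →L[𝕜] H}
    (hT : ‖T‖ ≤ 1) {x : H} : ‖T x‖ = ‖x‖ ↔ T.adjoint (T x) = x := by
  refine ⟨adjoint_apply_apply_eq_of_norm_eq hT, fun h => ?_⟩
  have h1 : ‖T x‖ ^ 2 = ‖x‖ ^ 2 := by
    rw [← @inner_self_eq_norm_sq 𝕜, ← ContinuousLinearMap.adjoint_inner_right, h,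
      inner_self_eq_norm_sq]
  exact (sq_eq_sq₀ (norm_nonneg _) (norm_nonneg _)).mp h1

theorem norm_apply_eq_of_mem_of_normAttainmentSet_eq {T : H →L[𝕜] H} (hT : ‖T‖ = 1)
    {H₀ : Submodule 𝕜 H} (hM : normAttainmentSet T = {x : H | x ∈ H₀ ∧ ‖x‖ = 1})
    {x : H} (hx : x ∈ H₀) : ‖T x‖ = ‖x‖ := by
  rcases eq_or_ne x 0 with rfl | h0
  · simp
  have hn : ‖x‖ ≠ 0 := norm_ne_zero_iff.mpr h0
  have : ((‖x‖⁻¹ : ℝ) : 𝕜) • x ∈ normAttainmentSet T := by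
    rw [hM]
    refine ⟨H₀.smul_mem _ hx, ?_⟩
    rw [norm_smul, norm_ofReal, abs_of_nonneg (by positivity), inv_mul_cancel₀ hn]
  have h2 := this.2
  rw [map_smul, norm_smul, norm_ofReal, abs_of_nonneg (by positivity), hT] at h2
  field_simp at h2
  exact h2

/-! ### The functionals `A ↦ ⟪T x, A y⟫` -/

/-- The functional `A ↦ ⟪T x, A y⟫` on bounded operators; it is conjugate-linear in `x` and linear
in `y`. -/
noncomputable def matrixCoeff (T : H →L[𝕜] H) (x y : H) : StrongDual 𝕜 (H →L[𝕜] H) :=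
  (innerSL 𝕜 (T x)) ∘L (ContinuousLinearMap.apply 𝕜 H y)

@[simp] theorem matrixCoeff_apply (T : H →L[𝕜] H) (x y : H) (A : H →L[𝕜] H) :
    matrixCoeff T x y A = ⟪T x, A y⟫_𝕜 := rfl

theorem matrixCoeff_self_mem_supportingFunctionals {T : H →L[𝕜] H} (hT : ‖T‖ ≤ 1) {x : H}
    (hx : ‖x‖ = 1) (hTx : ‖T x‖ = 1) : matrixCoeff T x x ∈ supportingFunctionals 𝕜 T := by
  have h1 : matrixCoeff T x x T = 1 := by simp [inner_self_eq_norm_sq_to_K, hTx]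
  refine ⟨le_antisymm ?_ ?_, h1⟩
  · refine ContinuousLinearMap.opNorm_le_bound _ zero_le_one fun A => ?_
    rw [matrixCoeff_apply]
    calc ‖⟪T x, A x⟫_𝕜‖ ≤ ‖T x‖ * ‖A x‖ := norm_inner_le_norm _ _
      _ ≤ 1 * ‖A‖ := by rw [hTx]; gcongr; simpa [hx] using A.le_opNorm x
  · have := (matrixCoeff T x x).le_opNorm T
    rw [h1, norm_one] at this
    nlinarith [norm_nonneg (matrixCoeff T x x)]

theorem matrixCoeff_self_mem_span {T : H →L[𝕜] H} (hT : ‖T‖ ≤ 1) {x : H} (hx : ‖T x‖ = ‖x‖) :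
    matrixCoeff T x x ∈ Submodule.span 𝕜 (supportingFunctionals 𝕜 T) := by
  rcases eq_or_ne x 0 with rfl | h0
  · convert Submodule.zero_mem _
    ext A; simp
  have hn : ‖x‖ ≠ 0 := norm_ne_zero_iff.mpr h0
  set u : H := ((‖x‖⁻¹ : ℝ) : 𝕜) • x with hu
  have hu1 : ‖u‖ = 1 := by
    rw [hu, norm_smul, norm_ofReal, abs_of_nonneg (by positivity), inv_mul_cancel₀ hn]
  have hTu : ‖T u‖ = 1 := by
    rw [hu, map_smul, norm_smul, norm_ofReal, abs_of_nonneg (by positivity), hx,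
      inv_mul_cancel₀ hn]
  have : matrixCoeff T x x = ((‖x‖ : 𝕜) ^ 2) • matrixCoeff T u u := by
    ext A
    have hn' : (‖x‖ : 𝕜) ≠ 0 := by exact_mod_cast hn
    simp only [hu, matrixCoeff_apply, smul_apply, map_smul, inner_smul_left,
      inner_smul_right, conj_ofReal, smul_eq_mul]
    rw [ofReal_inv]
    field_simp
  rw [this]
  exact Submodule.smul_mem _ _
    (Submodule.subset_span (matrixCoeff_self_mem_supportingFunctionals hT hu1 hTu))

theorem matrixCoeff_add_swap_mem_span {T : H →L[𝕜] H} (hT : ‖T‖ ≤ 1) {H₀ : Submodule 𝕜 H}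
    (hiso : ∀ x ∈ H₀, ‖T x‖ = ‖x‖) {x y : H} (hx : x ∈ H₀) (hy : y ∈ H₀) :
    matrixCoeff T x y + matrixCoeff T y x ∈
      Submodule.span 𝕜 (supportingFunctionals 𝕜 T) := by
  have : matrixCoeff T x y + matrixCoeff T y x =
      matrixCoeff T (x + y) (x + y) - matrixCoeff T x x - matrixCoeff T y y := by
    ext A
    simp [inner_add_left, inner_add_right]
    ring
  rw [this]
  exact Submodule.sub_mem _ (Submodule.sub_mem _
    (matrixCoeff_self_mem_span hT (hiso _ (H₀.add_mem hx hy)))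
    (matrixCoeff_self_mem_span hT (hiso _ hx))) (matrixCoeff_self_mem_span hT (hiso _ hy))

/-! ### Supporting functionals under a spectral gap -/

/-- If `A` changes the norm of `T x` only to second order for `x ∈ H₀`, that is
`re ⟪T x, A x⟫ = 0` there, then the gap `‖T y‖ ≤ s ‖y‖` on `H₀ᗮ` absorbs all remaining first order terms. -/
theorem exists_norm_add_smul_sq_le [CompleteSpace H] {T : H →L[𝕜] H} (hT : ‖T‖ ≤ 1)
    {H₀ : Submodule 𝕜 H} [H₀.HasOrthogonalProjection] (hiso : ∀ x ∈ H₀, ‖T x‖ = ‖x‖)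
    {s : ℝ} (hs0 : 0 ≤ s) (hs1 : s < 1) (hgap : ∀ y ∈ H₀ᗮ, ‖T y‖ ≤ s * ‖y‖)
    {A : H →L[𝕜] H} (hA : ∀ x ∈ H₀, re ⟪T x, A x⟫_𝕜 = 0) :
    ∃ C : ℝ, ∀ t : ℝ, ‖T + (t : 𝕜) • A‖ ^ 2 ≤ 1 + C * t ^ 2 := by
  set a := ‖A‖
  have ha0 : 0 ≤ a := norm_nonneg A
  set δ := 1 - s ^ 2 with hδ
  have hδ0 : 0 < δ := by nlinarith
  set C := a ^ 2 + 8 * a ^ 2 / δ with hC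
  have hC0 : 0 ≤ C := by positivity
  refine ⟨C, fun t => ?_⟩
  have hCt : 0 ≤ 1 + C * t ^ 2 := by positivity
  suffices h : ‖T + (t : 𝕜) • A‖ ≤ √(1 + C * t ^ 2) by
    calc ‖T + (t : 𝕜) • A‖ ^ 2 ≤ √(1 + C * t ^ 2) ^ 2 := by gcongr
      _ = _ := Real.sq_sqrt hCt
  refine ContinuousLinearMap.opNorm_le_bound _ (Real.sqrt_nonneg _) fun z => ?_
  refine le_of_sq_le_sq ?_ (by positivity)
  rw [mul_pow, Real.sq_sqrt hCt]
  set x := H₀.starProjection z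
  set y := H₀ᗮ.starProjection z
  have hx : x ∈ H₀ := H₀.starProjection_apply_mem z
  have hy : y ∈ H₀ᗮ := H₀ᗮ.starProjection_apply_mem z
  have hz : z = x + y := (H₀.starProjection_add_starProjection_orthogonal z).symm
  have hzn : ‖z‖ ^ 2 = ‖x‖ ^ 2 + ‖y‖ ^ 2 := H₀.norm_sq_eq_add_norm_sq_starProjection z
  have horth : ⟪T x, T y⟫_𝕜 = 0 := by
    rw [← ContinuousLinearMap.adjoint_inner_left, adjoint_apply_apply_eq_of_norm_eq hT (hiso x hx)]
    exact hy x hx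
  have hTz : ‖T z‖ ^ 2 ≤ ‖x‖ ^ 2 + s ^ 2 * ‖y‖ ^ 2 := by
    have h1 : ‖T y‖ ^ 2 ≤ (s * ‖y‖) ^ 2 := by gcongr; exact hgap y hy
    rw [hz, map_add, @norm_add_sq 𝕜, horth, hiso x hx]
    simp only [map_zero, mul_zero, add_zero]
    linarith [mul_pow s ‖y‖ 2]
  have hAz : ‖A z‖ ^ 2 ≤ a ^ 2 * (‖x‖ ^ 2 + ‖y‖ ^ 2) := by
    rw [← hzn, ← mul_pow]; gcongr; exact A.le_opNorm z
  have hb : ∀ u v : H, |re ⟪T u, A v⟫_𝕜| ≤ a * (‖u‖ * ‖v‖) := fun u v =>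
    calc |re ⟪T u, A v⟫_𝕜| ≤ ‖⟪T u, A v⟫_𝕜‖ := abs_re_le_norm _
      _ ≤ ‖T u‖ * ‖A v‖ := norm_inner_le_norm _ _
      _ ≤ ‖u‖ * (a * ‖v‖) := by
          gcongr
          · exact (T.le_of_opNorm_le hT u).trans (by simp)
          · exact A.le_opNorm v
      _ = _ := by ring
  have hcross : |re ⟪T z, A z⟫_𝕜| ≤ a * (2 * (‖x‖ * ‖y‖) + ‖y‖ ^ 2) := by
    have : re ⟪T z, A z⟫_𝕜 = re ⟪T x, A y⟫_𝕜 + re ⟪T y, A x⟫_𝕜 + re ⟪T y, A y⟫_𝕜 := by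
      rw [hz]
      simp only [map_add, inner_add_left, inner_add_right, hA x hx]
      ring
    rw [this]
    have h1 := abs_le.mp (hb x y)
    have h2 := abs_le.mp (hb y x)
    have h3 := abs_le.mp (hb y y)
    rw [abs_le]
    constructor <;> linarith
  have hexp : ‖(T + (t : 𝕜) • A) z‖ ^ 2 =
      ‖T z‖ ^ 2 + 2 * (t * re ⟪T z, A z⟫_𝕜) + t ^ 2 * ‖A z‖ ^ 2 := by
    rw [add_apply, smul_apply, @norm_add_sq 𝕜,
      inner_smul_right, re_ofReal_mul, norm_smul, norm_ofReal, mul_pow, sq_abs]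
  have htc : t * re ⟪T z, A z⟫_𝕜 ≤ |t| * (a * (2 * (‖x‖ * ‖y‖) + ‖y‖ ^ 2)) := by
    calc t * re ⟪T z, A z⟫_𝕜 ≤ |t * re ⟪T z, A z⟫_𝕜| := le_abs_self _
      _ = |t| * |re ⟪T z, A z⟫_𝕜| := abs_mul _ _
      _ ≤ _ := by gcongr
  -- Weighted arithmetic-geometric mean: each first order term costs at most `δ / 2 * ‖y‖ ^ 2`.
  have hamgm : ∀ p q : ℝ, 2 * (p * q) ≤ δ / 2 * q ^ 2 + 2 * p ^ 2 / δ := by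
    intro p q
    have : δ / 2 * q ^ 2 + 2 * p ^ 2 / δ - 2 * (p * q) = (δ * q - 2 * p) ^ 2 / (2 * δ) := by
      field_simp; ring
    have h0 : 0 ≤ (δ * q - 2 * p) ^ 2 / (2 * δ) := by positivity
    linarith
  have e1 := hamgm (2 * |t| * a * ‖x‖) ‖y‖
  have e2 := hamgm (|t| * a * ‖y‖) ‖y‖
  have f1 : 2 * (2 * |t| * a * ‖x‖) ^ 2 / δ = 8 * a ^ 2 / δ * t ^ 2 * ‖x‖ ^ 2 := by
    rw [mul_pow, mul_pow, mul_pow, sq_abs]; ring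
  have f2 : 2 * (|t| * a * ‖y‖) ^ 2 / δ = 2 * a ^ 2 / δ * t ^ 2 * ‖y‖ ^ 2 := by
    rw [mul_pow, mul_pow, sq_abs]; ring
  have f3 : 0 ≤ a ^ 2 / δ * t ^ 2 * ‖y‖ ^ 2 := by positivity
  have hAz' := mul_le_mul_of_nonneg_left hAz (sq_nonneg t)
  rw [f1] at e1
  rw [f2] at e2
  rw [hexp, hzn, hC]
  have g1 : (1 + (a ^ 2 + 8 * a ^ 2 / δ) * t ^ 2) * (‖x‖ ^ 2 + ‖y‖ ^ 2) =
      ‖x‖ ^ 2 + ‖y‖ ^ 2 + t ^ 2 * (a ^ 2 * (‖x‖ ^ 2 + ‖y‖ ^ 2)) +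
      8 * a ^ 2 / δ * t ^ 2 * ‖x‖ ^ 2 + 8 * (a ^ 2 / δ * t ^ 2 * ‖y‖ ^ 2) := by ring
  have g2 : 2 * a ^ 2 / δ * t ^ 2 * ‖y‖ ^ 2 = 2 * (a ^ 2 / δ * t ^ 2 * ‖y‖ ^ 2) := by ring
  rw [g1]
  rw [g2] at e2
  have g3 : s ^ 2 * ‖y‖ ^ 2 = ‖y‖ ^ 2 - δ * ‖y‖ ^ 2 := by rw [hδ]; ring
  linarith

theorem re_apply_eq_zero_of_norm_add_smul_sq_le {V : Type*} [NormedAddCommGroup V]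
    [NormedSpace 𝕜 V] {v w : V} {C : ℝ} (h : ∀ t : ℝ, ‖v + (t : 𝕜) • w‖ ^ 2 ≤ 1 + C * t ^ 2)
    {f : StrongDual 𝕜 V} (hf : f ∈ supportingFunctionals 𝕜 v) : re (f w) = 0 := by
  set r := re (f w)
  have key : ∀ t : ℝ, 2 * t * r ≤ C * t ^ 2 := by
    intro t
    have h1 : |1 + t * r| ≤ ‖v + (t : 𝕜) • w‖ := by
      have : re (f (v + (t : 𝕜) • w)) = 1 + t * r := by
        rw [map_add, map_smul, hf.2, smul_eq_mul, map_add, one_re, re_ofReal_mul]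
      rw [← this]
      refine (abs_re_le_norm _).trans ?_
      simpa [hf.1] using f.le_opNorm (v + (t : 𝕜) • w)
    have h2 : (1 + t * r) ^ 2 ≤ 1 + C * t ^ 2 := by
      rw [← sq_abs]; exact (pow_le_pow_left₀ (abs_nonneg _) h1 2).trans (h t)
    nlinarith [sq_nonneg (t * r)]
  -- The choice `t = r / (|C| + 1)` is small enough for the first order term to dominate.
  have hc : 0 < |C| + 1 := by positivity
  have h3 := key (r / (|C| + 1))
  have h4 : 2 * (r / (|C| + 1)) * r = 2 * (|C| + 1) * (r / (|C| + 1)) ^ 2 := by field_simp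
  have h5 : (2 * (|C| + 1) - C) * (r / (|C| + 1)) ^ 2 ≤ 0 := by rw [h4] at h3; linarith
  have h6 : 0 < 2 * (|C| + 1) - C := by linarith [le_abs_self C, abs_nonneg C]
  have h7 : (r / (|C| + 1)) ^ 2 = 0 :=
    le_antisymm (by by_contra! h; nlinarith [mul_pos h6 h]) (sq_nonneg _)
  have h8 : r / (|C| + 1) = 0 := by simpa using h7
  exact (div_eq_zero_iff.mp h8).resolve_right hc.ne'

/-- Under a spectral gap, a supporting functional of `T` only sees the quadratic form
`x ↦ ⟪T x, A x⟫` on `H₀`. -/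
theorem apply_eq_zero_of_forall_inner_eq_zero [CompleteSpace H] {T : H →L[𝕜] H} (hT : ‖T‖ ≤ 1)
    {H₀ : Submodule 𝕜 H} [H₀.HasOrthogonalProjection] (hiso : ∀ x ∈ H₀, ‖T x‖ = ‖x‖)
    (hgap : ‖T ∘L H₀ᗮ.subtypeL‖ < 1) {f : StrongDual 𝕜 (H →L[𝕜] H)}
    (hf : f ∈ supportingFunctionals 𝕜 T) {A : H →L[𝕜] H} (hA : ∀ x ∈ H₀, ⟪T x, A x⟫_𝕜 = 0) :
    f A = 0 := by
  have hre : ∀ B : H →L[𝕜] H, (∀ x ∈ H₀, ⟪T x, B x⟫_𝕜 = 0) → re (f B) = 0 := by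
    intro B hB
    obtain ⟨C, hC⟩ := exists_norm_add_smul_sq_le hT hiso (norm_nonneg _) hgap
      (fun y hy => (T ∘L H₀ᗮ.subtypeL).le_opNorm ⟨y, hy⟩)
      (A := B) (fun x hx => by rw [hB x hx, map_zero])
    exact re_apply_eq_zero_of_norm_add_smul_sq_le hC hf
  have h1 := hre A hA
  have h2 := hre ((I : 𝕜) • A) fun x hx => by
    rw [smul_apply, inner_smul_right, hA x hx, mul_zero]
  rw [map_smul, smul_eq_mul, I_mul_re, neg_eq_zero] at h2
  exact RCLike.ext (by simpa using h1) (by simpa using h2)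

section Basis

variable {T : H →L[𝕜] H} {H₀ : Submodule 𝕜 H} {ι : Type*} [Fintype ι]

theorem inner_apply_self_eq_sum (b : OrthonormalBasis ι 𝕜 H₀) (A : H →L[𝕜] H) {x : H}
    (hx : x ∈ H₀) : ⟪T x, A x⟫_𝕜 = ∑ i, ∑ j, starRingEnd 𝕜 (b.repr ⟨x, hx⟩ i) *
      b.repr ⟨x, hx⟩ j * ⟪T (b i), A (b j)⟫_𝕜 := by
  have h : x = ∑ i, b.repr ⟨x, hx⟩ i • (b i : H) := by
    have := congrArg (Subtype.val) (b.sum_repr ⟨x, hx⟩)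
    simpa using this.symm
  conv_lhs => rw [h]
  simp only [map_sum, map_smul, sum_inner, inner_sum, inner_smul_left, inner_smul_right]
  simp only [Finset.mul_sum]
  rw [Finset.sum_comm]
  refine Finset.sum_congr rfl fun i _ => Finset.sum_congr rfl fun j _ => ?_
  ring

theorem inner_apply_apply_basis [CompleteSpace H] [DecidableEq ι] (hT : ‖T‖ ≤ 1)
    (hiso : ∀ x ∈ H₀, ‖T x‖ = ‖x‖) (b : OrthonormalBasis ι 𝕜 H₀) (i j : ι) :
    ⟪T (b i), T (b j)⟫_𝕜 = if i = j then 1 else 0 := by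
  rw [← ContinuousLinearMap.adjoint_inner_left,
    adjoint_apply_apply_eq_of_norm_eq hT (hiso _ (b i).2), ← Submodule.coe_inner]
  exact orthonormal_iff_ite.mp b.orthonormal i j

theorem matrixCoeff_rankOne [CompleteSpace H] [DecidableEq ι] (hT : ‖T‖ ≤ 1)
    (hiso : ∀ x ∈ H₀, ‖T x‖ = ‖x‖) (b : OrthonormalBasis ι 𝕜 H₀) (i j k l : ι) :
    matrixCoeff T (b k) (b l) (InnerProductSpace.rankOne 𝕜 (T (b i)) (b j : H)) =
      if k = i ∧ l = j then 1 else 0 := by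
  have h := orthonormal_iff_ite.mp b.orthonormal j l
  rw [Submodule.coe_inner] at h
  rw [matrixCoeff_apply, InnerProductSpace.rankOne_apply, inner_smul_right,
    inner_apply_apply_basis hT hiso b, h]
  by_cases h1 : k = i <;> by_cases h2 : l = j <;> simp [h1, h2, Ne.symm]

end Basis

/-- In the complex case polarization recovers every `⟪T e_i, A e_j⟫`, so the supporting
functionals span a space of dimension `(dim H₀) ^ 2`. -/
theorem rank_span_supportingFunctionals_complex {H : Type*} [NormedAddCommGroup H]
    [InnerProductSpace ℂ H] [CompleteSpace H] {T : H →L[ℂ] H} (hT : ‖T‖ ≤ 1)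
    {H₀ : Submodule ℂ H} [FiniteDimensional ℂ H₀] (hiso : ∀ x ∈ H₀, ‖T x‖ = ‖x‖)
    (hgap : ‖T ∘L H₀ᗮ.subtypeL‖ < 1) :
    Module.rank ℂ (Submodule.span ℂ (supportingFunctionals ℂ T)) =
      ((Module.finrank ℂ H₀ ^ 2 : ℕ) : Cardinal) := by
  set b := stdOrthonormalBasis ℂ H₀
  set φ : Fin (Module.finrank ℂ H₀) × Fin (Module.finrank ℂ H₀) → StrongDual ℂ (H →L[ℂ] H) :=
    fun p => matrixCoeff T (b p.1) (b p.2) with hφ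
  have hspan : Submodule.span ℂ (supportingFunctionals ℂ T) =
      Submodule.span ℂ (Set.range φ) := by
    apply le_antisymm
    · rw [Submodule.span_le]
      intro f hf
      refine StrongDual.mem_span_range_of_forall_eq_zero φ f fun A hA => ?_
      refine apply_eq_zero_of_forall_inner_eq_zero hT hiso hgap hf fun x hx => ?_
      rw [inner_apply_self_eq_sum b A hx]
      refine Finset.sum_eq_zero fun i _ => Finset.sum_eq_zero fun j _ => ?_
      have : ⟪T (b i), A (b j)⟫_ℂ = 0 := hA (i, j)
      rw [this, mul_zero]
    · rw [Submodule.span_le]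
      rintro _ ⟨⟨i, j⟩, rfl⟩
      have h1 := matrixCoeff_add_swap_mem_span hT hiso (b i).2 (b j).2
      have h2 := matrixCoeff_add_swap_mem_span hT hiso (b i).2
        (H₀.smul_mem Complex.I (b j).2)
      have : φ (i, j) = (1 / 2 : ℂ) • ((matrixCoeff T (b i) (b j) + matrixCoeff T (b j) (b i)) -
          Complex.I • (matrixCoeff T (b i : H) (Complex.I • (b j : H)) +
            matrixCoeff T (Complex.I • (b j : H)) (b i))) := by
        ext A
        simp only [hφ, matrixCoeff_apply, smul_apply,
          sub_apply, add_apply, map_smul,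
          inner_smul_left, inner_smul_right, smul_eq_mul, Complex.conj_I]
        linear_combination (-(1 / 2 : ℂ) * ⟪T (b j), A (b i)⟫_ℂ +
          (1 / 2 : ℂ) * ⟪T (b i), A (b j)⟫_ℂ) * Complex.I_mul_I
      rw [this]
      exact Submodule.smul_mem _ _ (Submodule.sub_mem _ h1 (Submodule.smul_mem _ _ h2))
  have hli : LinearIndependent ℂ φ := by
    refine linearIndependent_of_forall_exists_separating φ fun ⟨i, j⟩ =>
      ⟨InnerProductSpace.rankOne ℂ (T (b i)) (b j : H), ?_, fun ⟨k, l⟩ hkl => ?_⟩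
    · simp only [hφ]
      rw [matrixCoeff_rankOne hT hiso b]
      simp
    · simp only [hφ]
      rw [matrixCoeff_rankOne hT hiso b, if_neg]
      rintro ⟨rfl, rfl⟩
      exact hkl rfl
  rw [StrongDual.rank_span_eq_card hli hspan]
  simp [sq]

/-- The functional `A ↦ ⟪T e_i, A e_j⟫ + ⟪T e_j, A e_i⟫` attached to the unordered pair `{i, j}`. -/
noncomputable def symmMatrixCoeff {ι : Type*} (T : H →L[𝕜] H) (e : ι → H) :
    Sym2 ι → StrongDual 𝕜 (H →L[𝕜] H) :=
  Sym2.lift ⟨fun i j => matrixCoeff T (e i) (e j) + matrixCoeff T (e j) (e i),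
    fun _ _ => add_comm _ _⟩

theorem symmMatrixCoeff_mk {ι : Type*} (T : H →L[𝕜] H) (e : ι → H) (i j : ι) :
    symmMatrixCoeff T e s(i, j) = matrixCoeff T (e i) (e j) + matrixCoeff T (e j) (e i) := rfl

theorem symmMatrixCoeff_mk_apply {ι : Type*} (T : H →L[𝕜] H) (e : ι → H) (i j : ι)
    (A : H →L[𝕜] H) :
    symmMatrixCoeff T e s(i, j) A = ⟪T (e i), A (e j)⟫_𝕜 + ⟪T (e j), A (e i)⟫_𝕜 := rfl

theorem linearIndependent_symmMatrixCoeff [CompleteSpace H] {T : H →L[𝕜] H} (hT : ‖T‖ ≤ 1)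
    {H₀ : Submodule 𝕜 H} (hiso : ∀ x ∈ H₀, ‖T x‖ = ‖x‖) {ι : Type*} [Fintype ι]
    (b : OrthonormalBasis ι 𝕜 H₀) :
    LinearIndependent 𝕜 (symmMatrixCoeff T fun i => (b i : H)) := by
  classical
  refine linearIndependent_of_forall_exists_separating _ fun p => ?_
  induction p using Sym2.ind with
  | _ i j =>
    refine ⟨InnerProductSpace.rankOne 𝕜 (T (b i)) (b j : H), ?_, fun q hq => ?_⟩
    · rw [symmMatrixCoeff_mk, add_apply, matrixCoeff_rankOne hT hiso b,
        matrixCoeff_rankOne hT hiso b, if_pos ⟨rfl, rfl⟩]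
      split_ifs <;> norm_num
    · induction q using Sym2.ind with
      | _ k l =>
        rw [symmMatrixCoeff_mk, add_apply, matrixCoeff_rankOne hT hiso b,
          matrixCoeff_rankOne hT hiso b, if_neg, if_neg, add_zero]
        · rintro ⟨rfl, rfl⟩
          exact hq Sym2.eq_swap
        · rintro ⟨rfl, rfl⟩
          exact hq rfl

theorem inner_apply_self_eq_zero_of_symmMatrixCoeff {H : Type*} [NormedAddCommGroup H]
    [InnerProductSpace ℝ H] {T A : H →L[ℝ] H} {H₀ : Submodule ℝ H} {ι : Type*} [Fintype ι]
    (b : OrthonormalBasis ι ℝ H₀)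
    (hA : ∀ p, symmMatrixCoeff T (fun i => (b i : H)) p A = 0) {x : H} (hx : x ∈ H₀) :
    ⟪T x, A x⟫_ℝ = 0 := by
  have hsum := inner_apply_self_eq_sum (T := T) b A hx
  -- Twice the quadratic form is its double sum plus the same sum with the indices swapped.
  have hsum' := hsum
  rw [Finset.sum_comm] at hsum'
  have h2 : ⟪T x, A x⟫_ℝ + ⟪T x, A x⟫_ℝ = 0 := by
    nth_rewrite 1 [hsum]
    rw [hsum', ← Finset.sum_add_distrib]
    refine Finset.sum_eq_zero fun i _ => ?_
    rw [← Finset.sum_add_distrib]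
    refine Finset.sum_eq_zero fun j _ => ?_
    have h := hA s(i, j)
    rw [symmMatrixCoeff_mk_apply] at h
    simp only [conj_trivial]
    linear_combination (b.repr ⟨x, hx⟩ i * b.repr ⟨x, hx⟩ j) * h
  linarith

/-- In the real case only the symmetric part of the matrix `⟪T e_i, A e_j⟫` is visible, so the
supporting functionals span a space of dimension `(dim H₀ + 1).choose 2`. -/
theorem rank_span_supportingFunctionals_real {H : Type*} [NormedAddCommGroup H]
    [InnerProductSpace ℝ H] [CompleteSpace H] {T : H →L[ℝ] H} (hT : ‖T‖ ≤ 1)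
    {H₀ : Submodule ℝ H} [FiniteDimensional ℝ H₀] (hiso : ∀ x ∈ H₀, ‖T x‖ = ‖x‖)
    (hgap : ‖T ∘L H₀ᗮ.subtypeL‖ < 1) :
    Module.rank ℝ (Submodule.span ℝ (supportingFunctionals ℝ T)) =
      (((Module.finrank ℝ H₀ + 1).choose 2 : ℕ) : Cardinal) := by
  let b := stdOrthonormalBasis ℝ H₀
  have hspan : Submodule.span ℝ (supportingFunctionals ℝ T) =
      Submodule.span ℝ (Set.range (symmMatrixCoeff T fun i => (b i : H))) := by
    apply le_antisymm
    · rw [Submodule.span_le]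
      intro f hf
      exact StrongDual.mem_span_range_of_forall_eq_zero _ f fun A hA =>
        apply_eq_zero_of_forall_inner_eq_zero hT hiso hgap hf fun x hx =>
          inner_apply_self_eq_zero_of_symmMatrixCoeff b hA hx
    · rw [Submodule.span_le]
      rintro _ ⟨p, rfl⟩
      induction p using Sym2.ind with
      | _ i j => exact matrixCoeff_add_swap_mem_span hT hiso (b i).2 (b j).2
  have hcard : Fintype.card (Sym2 (Fin (Module.finrank ℝ H₀))) =
      (Module.finrank ℝ H₀ + 1).choose 2 := by
    rw [Sym2.card, Fintype.card_fin]
  rw [StrongDual.rank_span_eq_card (linearIndependent_symmMatrixCoeff hT hiso b) hspan, hcard]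

/-! ### Failure of the gap forces infinite order -/

/-- If `v + w` and `v - w` are in the unit ball then a functional supporting `v` kills `w`. -/
theorem apply_eq_zero_of_norm_add_le_of_norm_sub_le {V : Type*} [NormedAddCommGroup V]
    [NormedSpace 𝕜 V] {v w : V} (h1 : ‖v + w‖ ≤ 1) (h2 : ‖v - w‖ ≤ 1) {f : StrongDual 𝕜 V}
    (hf : f ∈ supportingFunctionals 𝕜 v) : f w = 0 := by
  have k1 : ‖1 + f w‖ ≤ 1 := by
    rw [← hf.2, ← map_add]
    exact (f.le_opNorm _).trans (by rw [hf.1, one_mul]; exact h1)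
  have k2 : ‖1 - f w‖ ≤ 1 := by
    rw [← hf.2, ← map_sub]
    exact (f.le_opNorm _).trans (by rw [hf.1, one_mul]; exact h2)
  have k3 := @parallelogram_law_with_norm 𝕜 𝕜 _ _ _ 1 (f w)
  rw [norm_one] at k3
  have : ‖f w‖ = 0 := by
    nlinarith [norm_nonneg (f w), norm_nonneg (1 + f w), norm_nonneg (1 - f w)]
  exact norm_eq_zero.mp this

theorem norm_starProjection_add_le_one {U V : Submodule 𝕜 H} [U.HasOrthogonalProjection]
    [V.HasOrthogonalProjection] (h : U ⟂ V) {c : 𝕜} (hc : ‖c‖ ≤ 1) :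
    ‖U.starProjection + c • V.starProjection‖ ≤ 1 := by
  refine ContinuousLinearMap.opNorm_le_bound _ zero_le_one fun x => ?_
  rw [one_mul]
  refine le_of_sq_le_sq ?_ (norm_nonneg x)
  have h0 : ⟪U.starProjection x, V.starProjection x⟫_𝕜 = 0 :=
    Submodule.isOrtho_iff_inner_eq.mp h _ (U.starProjection_apply_mem x) _
      (V.starProjection_apply_mem x)
  have h1 : V.starProjection x = V.starProjection (Uᗮ.starProjection x) := by
    conv_lhs => rw [← U.starProjection_add_starProjection_orthogonal x]
    rw [map_add, (V.starProjection_apply_eq_zero_iff).mpr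
      (h.le (U.starProjection_apply_mem x)), zero_add]
  have h2 : ‖V.starProjection x‖ ≤ ‖Uᗮ.starProjection x‖ := by
    rw [h1]; exact V.norm_starProjection_apply_le _
  have h3 : ‖c • V.starProjection x‖ ≤ ‖Uᗮ.starProjection x‖ := by
    rw [norm_smul]
    exact (mul_le_of_le_one_left (norm_nonneg _) hc).trans h2
  rw [add_apply, smul_apply, @norm_add_sq 𝕜,
    inner_smul_right, h0, U.norm_sq_eq_add_norm_sq_starProjection x]
  simp only [mul_zero, map_zero, add_zero]
  gcongr

theorem apply_comp_starProjection_eq_zero {T : H →L[𝕜] H} (hT : ‖T‖ ≤ 1) {U V : Submodule 𝕜 H}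
    [U.HasOrthogonalProjection] [V.HasOrthogonalProjection] (h : U ⟂ V)
    {f : StrongDual 𝕜 (H →L[𝕜] H)}
    (hf : f ∈ supportingFunctionals 𝕜 (T ∘L U.starProjection)) :
    f (T ∘L V.starProjection) = 0 := by
  have key : ∀ c : 𝕜, ‖c‖ ≤ 1 →
      ‖T ∘L U.starProjection + c • (T ∘L V.starProjection)‖ ≤ 1 := by
    intro c hc
    rw [← ContinuousLinearMap.comp_smul, ← ContinuousLinearMap.comp_add]
    exact (ContinuousLinearMap.opNorm_comp_le _ _).trans
      (mul_le_one₀ hT (norm_nonneg _) (norm_starProjection_add_le_one h hc))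
  refine apply_eq_zero_of_norm_add_le_of_norm_sub_le ?_ ?_ hf
  · simpa using key 1 (by simp)
  · simpa [sub_eq_add_neg] using key (-1) (by simp)

/-- A sequence of mutually orthogonal subspaces on each of which `T` has norm one gives infinitely
many independent supporting functionals: one supporting `T ∘ P_k` for each projection `P_k`. -/
theorem exists_linearIndependent_supportingFunctionals {T : H →L[𝕜] H} (hT : ‖T‖ ≤ 1)
    (U : ℕ → Submodule 𝕜 H) [∀ k, (U k).HasOrthogonalProjection]
    (hU : Pairwise fun k l => U k ⟂ U l) (hn : ∀ k, ‖T ∘L (U k).starProjection‖ = 1) :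
    ∃ f : ℕ → StrongDual 𝕜 (H →L[𝕜] H),
      LinearIndependent 𝕜 f ∧ ∀ k, f k ∈ supportingFunctionals 𝕜 T := by
  have hex : ∀ k, ∃ f, f ∈ supportingFunctionals 𝕜 (T ∘L (U k).starProjection) := by
    intro k
    obtain ⟨g, hg, hg'⟩ := exists_dual_vector 𝕜 (T ∘L (U k).starProjection) (by simp [hn k])
    exact ⟨g, hg, by rw [hg', hn k, ofReal_one]⟩
  choose f hf using hex
  refine ⟨f, linearIndependent_of_forall_exists_separating f fun k =>
    ⟨T ∘L (U k).starProjection, by simp [(hf k).2], fun l hl =>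
      apply_comp_starProjection_eq_zero hT (hU hl) (hf l)⟩, fun k => ⟨(hf k).1, ?_⟩⟩
  have h1 := apply_comp_starProjection_eq_zero hT (U k).isOrtho_orthogonal_right (hf k)
  have h2 : T = T ∘L (U k).starProjection + T ∘L (U k)ᗮ.starProjection := by
    ext x
    rw [add_apply, ContinuousLinearMap.comp_apply,
      ContinuousLinearMap.comp_apply, ← map_add,
      Submodule.starProjection_add_starProjection_orthogonal]
  rw [h2, map_add, h1, add_zero, (hf k).2]

/-- The sequence is built greedily: each new vector is chosen in the orthogonal complement of the
span of the previous ones. -/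
theorem exists_orthogonal_seq_of_no_gap {T : H →L[𝕜] H}
    (h : ∀ F : Submodule 𝕜 H, FiniteDimensional 𝕜 F → ¬ ‖T ∘L Fᗮ.subtypeL‖ < 1) :
    ∃ e : ℕ → H, (Pairwise fun m n => ⟪e m, e n⟫_𝕜 = 0) ∧
      ∀ n : ℕ, (1 - 1 / ((n : ℝ) + 1)) * ‖e n‖ < ‖T (e n)‖ := by
  classical
  obtain ⟨f, hf, hr⟩ := exists_seq_of_forall_finset_exists
    (fun p : ℕ × H => (1 - 1 / ((p.1 : ℝ) + 1)) * ‖p.2‖ < ‖T p.2‖)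
    (fun p q => p.1 < q.1 ∧ ⟪p.2, q.2⟫_𝕜 = 0) (by
      intro s _
      obtain ⟨N, hN⟩ := (s.image Prod.fst).bddAbove
      have hN' : ∀ p ∈ s, p.1 ≤ N := fun p hp =>
        hN (Finset.mem_coe.mpr (Finset.mem_image_of_mem _ hp))
      set F := Submodule.span 𝕜 ((s.image Prod.snd : Finset H) : Set H)
      have hF : FiniteDimensional 𝕜 F := FiniteDimensional.span_finset 𝕜 _
      by_contra! hcon
      refine h F hF (lt_of_le_of_lt (ContinuousLinearMap.opNorm_le_bound _
        (M := 1 - 1 / (((N + 1 : ℕ) : ℝ) + 1)) ?_ ?_) ?_)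
      · rw [sub_nonneg, div_le_one (by positivity)]
        simp only [le_add_iff_nonneg_left]
        positivity
      · intro y
        by_contra! hy
        obtain ⟨p, hp, hp'⟩ := hcon (N + 1, (y : H)) hy
        exact hp' (Nat.lt_succ_of_le (hN' p hp)) (y.2 p.2
          (Submodule.subset_span (Finset.mem_coe.mpr (Finset.mem_image_of_mem _ hp))))
      · have : 0 < 1 / (((N + 1 : ℕ) : ℝ) + 1) := by positivity
        linarith)
  have hmono : StrictMono fun n => (f n).1 := fun m n hmn => (hr m n hmn).1
  refine ⟨fun n => (f n).2, fun m n hmn => ?_, fun n => lt_of_le_of_lt ?_ (hf n)⟩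
  · rcases lt_or_gt_of_ne hmn with h' | h'
    · exact (hr m n h').2
    · exact inner_eq_zero_symm.mp (hr n m h').2
  · have : (n : ℝ) ≤ (f n).1 := by exact_mod_cast hmono.id_le n
    gcongr

theorem Submodule.isOrtho_topologicalClosure_left {U V : Submodule 𝕜 H} (h : U ⟂ V) :
    U.topologicalClosure ⟂ V :=
  Submodule.topologicalClosure_minimal _ h V.isClosed_orthogonal

/-- If the span of the supporting functionals of `T` is finite-dimensional then `T` has norm less
than one on the complement of some finite-dimensional subspace. Otherwise an orthogonal sequence
on which `T` is asymptotically isometric splits into infinitely many subsequences, whose closed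
spans are mutually orthogonal, and `T` has norm one on each of them. -/
theorem exists_finiteDimensional_gap [CompleteSpace H] {T : H →L[𝕜] H} (hT : ‖T‖ = 1)
    (hfin : FiniteDimensional 𝕜 (Submodule.span 𝕜 (supportingFunctionals 𝕜 T))) :
    ∃ F : Submodule 𝕜 H, FiniteDimensional 𝕜 F ∧ ‖T ∘L Fᗮ.subtypeL‖ < 1 := by
  by_contra! hcon
  obtain ⟨e, he, hTe⟩ := exists_orthogonal_seq_of_no_gap
    (T := T) (fun F hF => not_lt.mpr (hcon F hF))
  -- The pairing function splits the sequence into infinitely many subsequences, indexed by `k`.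
  set U : ℕ → Submodule 𝕜 H := fun k =>
    (Submodule.span 𝕜 (Set.range fun j => e (Nat.pair k j))).topologicalClosure
  have : ∀ k, CompleteSpace (U k) := fun k =>
    (Submodule.isClosed_topologicalClosure _).completeSpace_coe
  have hU : Pairwise fun k l => U k ⟂ U l := by
    intro k l hkl
    suffices h : Submodule.span 𝕜 (Set.range fun j => e (Nat.pair k j)) ⟂
        Submodule.span 𝕜 (Set.range fun j => e (Nat.pair l j)) from
      Submodule.isOrtho_topologicalClosure_left
        (Submodule.isOrtho_topologicalClosure_left h).symm |>.symm
    rw [Submodule.isOrtho_span]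
    rintro _ ⟨i, rfl⟩ _ ⟨j, rfl⟩
    exact he fun h => hkl (Nat.pair_eq_pair.mp h).1
  have hn : ∀ k, ‖T ∘L (U k).starProjection‖ = 1 := by
    intro k
    apply le_antisymm
    · exact (ContinuousLinearMap.opNorm_comp_le _ _).trans
        (mul_le_one₀ hT.le (norm_nonneg _) (U k).starProjection_norm_le)
    · have hlim : Filter.Tendsto (fun j : ℕ => 1 - 1 / ((j : ℝ) + 1)) Filter.atTop (nhds 1) := by
        simpa using (tendsto_one_div_add_atTop_nhds_zero_nat (𝕜 := ℝ)).const_sub 1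
      refine le_of_tendsto' hlim fun j => ?_
      set x := e (Nat.pair k j)
      have hx : x ∈ U k :=
        Submodule.le_topologicalClosure _ (Submodule.subset_span ⟨j, rfl⟩)
      have h1 : ‖T x‖ ≤ ‖T ∘L (U k).starProjection‖ * ‖x‖ := by
        have := (T ∘L (U k).starProjection).le_opNorm x
        rwa [ContinuousLinearMap.comp_apply,
          (U k).starProjection_eq_self_iff.mpr hx] at this
      have hx0 : 0 < ‖x‖ := by
        rw [norm_pos_iff]
        intro h0
        have := hTe (Nat.pair k j)
        change _ * ‖x‖ < ‖T x‖ at this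
        simp [h0] at this
      have h2 := le_of_mul_le_mul_right ((hTe (Nat.pair k j)).le.trans h1) hx0
      refine le_trans ?_ h2
      have : (j : ℝ) ≤ (Nat.pair k j : ℕ) := by exact_mod_cast Nat.right_le_pair k j
      gcongr
  obtain ⟨f, hli, hf⟩ := exists_linearIndependent_supportingFunctionals hT.le U hU hn
  have hli' : LinearIndependent 𝕜 (fun k =>
      (⟨f k, Submodule.subset_span (hf k)⟩ :
        Submodule.span 𝕜 (supportingFunctionals 𝕜 T))) :=
    LinearIndependent.of_comp (Submodule.subtype _) hli
  exact not_finite_iff_infinite.mpr inferInstance hli'.finite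

/-! ### From some gap to the gap on the fixed space of `T†T` -/

/-- The fixed space of `T†T`. -/
noncomputable def isometrySubspace [CompleteSpace H] (T : H →L[𝕜] H) : Submodule 𝕜 H :=
  LinearMap.ker ((ContinuousLinearMap.id 𝕜 H - T.adjoint ∘L T : H →L[𝕜] H) : H →ₗ[𝕜] H)

theorem mem_isometrySubspace [CompleteSpace H] {T : H →L[𝕜] H} (hT : ‖T‖ ≤ 1) {x : H} :
    x ∈ isometrySubspace T ↔ ‖T x‖ = ‖x‖ := by
  rw [norm_apply_eq_iff_adjoint_apply_apply_eq hT, isometrySubspace, LinearMap.mem_ker]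
  change x - T.adjoint (T x) = 0 ↔ _
  rw [sub_eq_zero, eq_comm]

theorem normAttainmentSet_eq_isometrySubspace [CompleteSpace H] {T : H →L[𝕜] H} (hT : ‖T‖ = 1) :
    normAttainmentSet T = {x : H | x ∈ isometrySubspace T ∧ ‖x‖ = 1} := by
  ext x
  simp only [normAttainmentSet, Set.mem_ofPred_eq, mem_isometrySubspace hT.le, hT]
  constructor
  · rintro ⟨h1, h2⟩; exact ⟨h2.trans h1.symm, h1⟩
  · rintro ⟨h1, h2⟩; exact ⟨h2, h1.trans h2⟩

theorem finiteDimensional_isometrySubspace [CompleteSpace H] {T : H →L[𝕜] H} (hT : ‖T‖ ≤ 1)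
    {F : Submodule 𝕜 H} [FiniteDimensional 𝕜 F] (hF : ‖T ∘L Fᗮ.subtypeL‖ < 1) :
    FiniteDimensional 𝕜 (isometrySubspace T) := by
  set p : isometrySubspace T →ₗ[𝕜] F :=
    (F.orthogonalProjectionOnto : H →ₗ[𝕜] F) ∘ₗ (isometrySubspace T).subtype
  refine FiniteDimensional.of_injective p ((injective_iff_map_eq_zero p).mpr fun x hx => ?_)
  have hxF : (x : H) ∈ Fᗮ := Submodule.orthogonalProjectionOnto_eq_zero_iff.mp hx
  have h1 := (T ∘L Fᗮ.subtypeL).le_opNorm ⟨x, hxF⟩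
  have h2 : ‖T x‖ = ‖(x : H)‖ := (mem_isometrySubspace hT).mp x.2
  have h3 : ‖(x : H)‖ ≤ ‖T ∘L Fᗮ.subtypeL‖ * ‖(x : H)‖ := h2 ▸ h1
  have h4 : ‖(x : H)‖ = 0 := by
    by_contra h
    have : 0 < ‖(x : H)‖ := lt_of_le_of_ne (norm_nonneg _) (Ne.symm h)
    nlinarith
  exact Subtype.ext (norm_eq_zero.mp h4)

/-- Where `T` shrinks norms by a factor `s < 1`, the operator `1 - T†T` is bounded below. -/
theorem mul_norm_le_norm_sub_adjoint_apply [CompleteSpace H] {T : H →L[𝕜] H} {s : ℝ}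
    {y : H} (hy : ‖T y‖ ≤ s * ‖y‖) :
    (1 - s ^ 2) * ‖y‖ ≤ ‖y - T.adjoint (T y)‖ := by
  rcases eq_or_ne y 0 with rfl | h0
  · simp
  have hn : 0 < ‖y‖ := norm_pos_iff.mpr h0
  have h1 : re ⟪y, y - T.adjoint (T y)⟫_𝕜 = ‖y‖ ^ 2 - ‖T y‖ ^ 2 := by
    rw [inner_sub_right, ContinuousLinearMap.adjoint_inner_right, map_sub, inner_self_eq_norm_sq,
      inner_self_eq_norm_sq]
  have h2 : re ⟪y, y - T.adjoint (T y)⟫_𝕜 ≤ ‖y‖ * ‖y - T.adjoint (T y)‖ := re_inner_le_norm _ _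
  have h3 : ‖T y‖ ^ 2 ≤ (s * ‖y‖) ^ 2 := by gcongr
  refine le_of_mul_le_mul_left ?_ hn
  nlinarith

/-- A norm gap on some finite-codimensional `Fᗮ` improves to a gap on the complement of the fixed
space of `T†T`: a maximizing sequence would have a convergent subsequence, whose limit is a fixed
unit vector. -/
theorem norm_comp_isometrySubspace_orthogonal_lt_one [CompleteSpace H] {T : H →L[𝕜] H}
    (hT : ‖T‖ ≤ 1) {F : Submodule 𝕜 H} [FiniteDimensional 𝕜 F] (hF : ‖T ∘L Fᗮ.subtypeL‖ < 1) :
    ‖T ∘L (isometrySubspace T)ᗮ.subtypeL‖ < 1 := by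
  by_contra! hcon
  set s := ‖T ∘L Fᗮ.subtypeL‖
  set D : H →L[𝕜] H := ContinuousLinearMap.id 𝕜 H - T.adjoint ∘L T
  have hDa : ∀ x, D x = x - T.adjoint (T x) := fun x => rfl
  have hδ : 0 < 1 - s ^ 2 := by nlinarith [norm_nonneg (T ∘L Fᗮ.subtypeL)]
  have hex : ∀ n : ℕ, ∃ x ∈ (isometrySubspace T)ᗮ, ‖x‖ = 1 ∧ 1 - 1 / ((n : ℝ) + 1) < ‖T x‖ := by
    intro n
    have hp : 0 < 1 / ((n : ℝ) + 1) := by positivity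
    have hnn : 0 ≤ 1 - 1 / ((n : ℝ) + 1) := by
      rw [sub_nonneg, div_le_one (by positivity)]; simp
    have hlt : ¬ ‖T ∘L (isometrySubspace T)ᗮ.subtypeL‖ ≤ 1 - 1 / ((n : ℝ) + 1) := by
      intro h; linarith
    have : ∃ y : (isometrySubspace T)ᗮ, (1 - 1 / ((n : ℝ) + 1)) * ‖y‖ < ‖T y‖ := by
      by_contra! h
      exact hlt (ContinuousLinearMap.opNorm_le_bound _ hnn h)
    obtain ⟨y, hy⟩ := this
    have hy0 : 0 < ‖(y : H)‖ := by
      rw [norm_pos_iff]; intro h0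
      rw [h0, map_zero, norm_zero] at hy
      exact absurd hy (not_lt.mpr (by positivity))
    refine ⟨((‖(y : H)‖⁻¹ : ℝ) : 𝕜) • (y : H), (isometrySubspace T)ᗮ.smul_mem _ y.2, ?_, ?_⟩
    · rw [norm_smul, norm_ofReal, abs_of_nonneg (by positivity), inv_mul_cancel₀ hy0.ne']
    · rw [map_smul, norm_smul, norm_ofReal, abs_of_nonneg (by positivity), inv_mul_eq_div,
        lt_div_iff₀ hy0]
      exact hy
  choose x hxm hx1 hxT using hex
  have hDx : Filter.Tendsto (fun n => D (x n)) Filter.atTop (nhds 0) := by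
    have hlim : Filter.Tendsto (fun n : ℕ => 2 * (1 / ((n : ℝ) + 1))) Filter.atTop (nhds 0) := by
      simpa using (tendsto_one_div_add_atTop_nhds_zero_nat (𝕜 := ℝ)).const_mul 2
    have hsq : Filter.Tendsto (fun n => ‖D (x n)‖ ^ 2) Filter.atTop (nhds 0) := by
      refine squeeze_zero (fun n => sq_nonneg _) (fun n => ?_) hlim
      have h1 := norm_sub_adjoint_apply_sq_le hT (x n)
      rw [← hDa, hx1] at h1
      have h2 := hxT n
      nlinarith [sq_nonneg (1 - ‖T (x n)‖)]
    rw [tendsto_zero_iff_norm_tendsto_zero]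
    simpa using hsq.sqrt
  -- The components in `F` have a convergent subsequence.
  obtain ⟨a, -, θ, hθ, ha⟩ := tendsto_subseq_of_bounded
    (Metric.isBounded_closedBall (x := (0 : F)) (r := 1)) (x := fun n => F.orthogonalProjectionOnto (x n)) (fun n => by
      rw [mem_closedBall_zero_iff]
      have := F.norm_starProjection_apply_le (x n)
      rwa [hx1] at this)
  have ha' : Filter.Tendsto (fun n => F.starProjection (x (θ n))) Filter.atTop (nhds (a : H)) :=
    (continuous_subtype_val.tendsto a).comp ha
  set y : ℕ → H := fun n => Fᗮ.starProjection (x (θ n))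
  have hxy : ∀ n, x (θ n) = F.starProjection (x (θ n)) + y n := fun n =>
    (F.starProjection_add_starProjection_orthogonal _).symm
  have hDy : Filter.Tendsto (fun n => D (y n)) Filter.atTop (nhds (0 - D a)) := by
    have h1 : ∀ n, D (y n) = D (x (θ n)) - D (F.starProjection (x (θ n))) := fun n => by
      rw [← map_sub]; congr 1; exact eq_sub_of_add_eq' (hxy n).symm
    simp_rw [h1]
    exact (hDx.comp hθ.tendsto_atTop).sub ((D.continuous.tendsto _).comp ha')
  -- The components in `Fᗮ` converge too, because `D` is bounded below there.
  have hyc : CauchySeq y := by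
    rw [Metric.cauchySeq_iff']
    intro ε hε
    obtain ⟨N, hN⟩ := Metric.cauchySeq_iff'.mp hDy.cauchySeq ((1 - s ^ 2) * ε) (by positivity)
    refine ⟨N, fun n hn => ?_⟩
    have h1 := hN n hn
    have hmem : y n - y N ∈ Fᗮ := Submodule.sub_mem _
      (Fᗮ.starProjection_apply_mem _) (Fᗮ.starProjection_apply_mem _)
    have h2 : (1 - s ^ 2) * ‖y n - y N‖ ≤ ‖D (y n - y N)‖ :=
      mul_norm_le_norm_sub_adjoint_apply ((T ∘L Fᗮ.subtypeL).le_opNorm ⟨_, hmem⟩)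
    rw [dist_eq_norm] at h1 ⊢
    rw [map_sub] at h2
    exact lt_of_mul_lt_mul_left (h2.trans_lt h1) hδ.le
  obtain ⟨b, hb⟩ := cauchySeq_tendsto_of_complete hyc
  have hxl : Filter.Tendsto (fun n => x (θ n)) Filter.atTop (nhds ((a : H) + b)) := by
    have := ha'.add hb
    exact this.congr fun n => (hxy n).symm
  have hl1 : ‖(a : H) + b‖ = 1 :=
    tendsto_nhds_unique hxl.norm (by simp [hx1])
  have hlD : D ((a : H) + b) = 0 :=
    tendsto_nhds_unique ((D.continuous.tendsto _).comp hxl) (hDx.comp hθ.tendsto_atTop)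
  have hlm : (a : H) + b ∈ (isometrySubspace T)ᗮ :=
    (Submodule.isClosed_orthogonal _).mem_of_tendsto hxl (Filter.Eventually.of_forall fun n => hxm _)
  have h0 : ⟪(a : H) + b, (a : H) + b⟫_𝕜 = 0 := hlm _ hlD
  rw [inner_self_eq_zero] at h0
  rw [h0, norm_zero] at hl1
  exact zero_ne_one hl1

/-- A rank formula `d (dim H₀)` for the span of the supporting functionals under a gap, with `d`
injective, turns into the characterization of `d n`-smoothness. -/
theorem isSmoothOfOrder_iff_of_rank_formula [CompleteSpace H] {T : H →L[𝕜] H} (hT : ‖T‖ = 1)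
    {d : ℕ → ℕ} (hd : Function.Injective d)
    (hrank : ∀ H₀ : Submodule 𝕜 H, FiniteDimensional 𝕜 H₀ → (∀ x ∈ H₀, ‖T x‖ = ‖x‖) →
      ‖T ∘L H₀ᗮ.subtypeL‖ < 1 →
      Module.rank 𝕜 (Submodule.span 𝕜 (supportingFunctionals 𝕜 T)) =
        (d (Module.finrank 𝕜 H₀) : Cardinal)) (n : ℕ) :
    IsSmoothOfOrder 𝕜 (d n) T ↔
      ∃ H₀ : Submodule 𝕜 H, FiniteDimensional 𝕜 H₀ ∧ Module.finrank 𝕜 H₀ = n ∧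
        normAttainmentSet T = {x : H | x ∈ H₀ ∧ ‖x‖ = 1} ∧ ‖T ∘L H₀ᗮ.subtypeL‖ < 1 := by
  constructor
  · rintro ⟨-, hr⟩
    have hfin : FiniteDimensional 𝕜 (Submodule.span 𝕜 (supportingFunctionals 𝕜 T)) := by
      exact finiteDimensional_of_rank_eq_natCast hr
    obtain ⟨F, hF, hgap⟩ := exists_finiteDimensional_gap hT hfin
    have h1 := finiteDimensional_isometrySubspace hT.le hgap
    have h2 := norm_comp_isometrySubspace_orthogonal_lt_one hT.le hgap
    refine ⟨isometrySubspace T, h1, ?_, normAttainmentSet_eq_isometrySubspace hT, h2⟩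
    have h3 := hrank _ h1 (fun x hx => (mem_isometrySubspace hT.le).mp hx) h2
    rw [hr] at h3
    exact hd (by exact_mod_cast h3.symm)
  · rintro ⟨H₀, hfin, rfl, hM, hgap⟩
    exact ⟨hT, hrank H₀ hfin
      (fun x hx => norm_apply_eq_of_mem_of_normAttainmentSet_eq hT hM hx) hgap⟩

theorem injective_succ_choose_two : Function.Injective fun n : ℕ => (n + 1).choose 2 := by
  refine (strictMono_nat_of_lt_succ fun n => ?_).injective
  have h : (n + 1 + 1).choose 2 = (n + 1).choose 1 + (n + 1).choose 2 :=
    Nat.choose_succ_succ' _ _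
  rw [Nat.choose_one_right] at h
  omega

end

theorem mainTheorem1 :
    (∀ (H : Type*) [NormedAddCommGroup H] [InnerProductSpace ℂ H] [CompleteSpace H]
        [TopologicalSpace.SeparableSpace H] (T : H →L[ℂ] H), ‖T‖ = 1 → ∀ n : ℕ,
        (IsSmoothOfOrder ℂ (n ^ 2) T ↔
          ∃ H₀ : Submodule ℂ H, FiniteDimensional ℂ H₀ ∧ Module.finrank ℂ H₀ = n ∧
            normAttainmentSet T = {x : H | x ∈ H₀ ∧ ‖x‖ = 1} ∧
            ‖T ∘L H₀ᗮ.subtypeL‖ < 1)) ∧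
    (∀ (H : Type*) [NormedAddCommGroup H] [InnerProductSpace ℝ H] [CompleteSpace H]
        [TopologicalSpace.SeparableSpace H] (T : H →L[ℝ] H), ‖T‖ = 1 → ∀ n : ℕ,
        (IsSmoothOfOrder ℝ ((n + 1).choose 2) T ↔
          ∃ H₀ : Submodule ℝ H, FiniteDimensional ℝ H₀ ∧ Module.finrank ℝ H₀ = n ∧
            normAttainmentSet T = {x : H | x ∈ H₀ ∧ ‖x‖ = 1} ∧
            ‖T ∘L H₀ᗮ.subtypeL‖ < 1)) := by
  refine ⟨fun H _ _ _ _ T hT n => ?_, fun H _ _ _ _ T hT n => ?_⟩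
  · exact isSmoothOfOrder_iff_of_rank_formula hT (d := fun n => n ^ 2)
      (Nat.pow_left_injective two_ne_zero)
      (fun H₀ _ hiso hgap => rank_span_supportingFunctionals_complex hT.le hiso hgap) n
  · exact isSmoothOfOrder_iff_of_rank_formula hT (d := fun n => (n + 1).choose 2)
      injective_succ_choose_two
      (fun H₀ _ hiso hgap => rank_span_supportingFunctionals_real hT.le hiso hgap) n
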